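/- Let $F$ be a field of characteristic different from $2$. An $F$-algebra with involution is a pair $(A,\sigma)$, where $A$ is a finite-dimensional simple $F$-algebra with centre $K$ and $\sigma$ is an involution on $A$ such that $F=K\cap \mathrm{Sym}(A,\sigma)$, with $\mathrm{Sym}(A,\sigma)=\{a\in A\mid \sigma(a)=a\}$. Its type is unitary if $K\neq F$; if $K=F$ and $\dim_F A=n^2$, it is orthogonal or symplectic according to whether $\dim_F\mathrm{Sym}(A,\sigma)$ is $n(n+1)/2$ or $n(n-1)/2$. Let $\mathrm{Herm}(A,\sigma)$ be the category of (possibly singular) hermitian forms over $(A,\sigma)$ on finitely generated right $A$-modules. For $(M,h)\in\mathrm{Herm}(A,\sigma)$ let $D_{(A,\sigma)}(h)=\{u\in\mathrm{Sym}(A,\sigma)\mid u=h(x,x)\text{ for some }x\in M\}$, and for $a_1,\dots,a_k\in\mathrm{Sym}(A,\sigma)$ let $\langle a_1,\dots,a_k\rangle_\sigma$ be the diagonal form $(x,y)\mapsto\sum_i\sigma(x_i)a_iy_i$ on $A^k$. For $S\subseteq \mathrm{Sym}(A,\sigma)$ let $\mathrm{Diag}(S)$ be the set of all diagonal forms with coefficients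 in $S$. A prepositive cone on $(A,\sigma)$ is a nonempty set $\mathscr P\subseteq\mathrm{Sym}(A,\sigma)$ such that $\mathscr P+\mathscr P\subseteq\mathscr P$; $\sigma(a)\mathscr Pa\subseteq\mathscr P$ for all $a\in A$; $\mathscr P_F:=\{u\in F\mid u\mathscr P\subseteq\mathscr P\}$ is (the set of nonnegative elements of) an ordering of $F$; and $\mathscr P\cap-\mathscr P=\{0\}$. It is over the ordering $P$ if $\mathscr P_F=P$. A positive cone is a prepositive cone that is maximal with respect to inclusion. Let $Y_{(A,\sigma)}$ and $X_{(A,\sigma)}$ be the sets of prepositive and of positive cones on $(A,\sigma)$. Let $(A,\sigma)$ and $(B,\tau)$ be $F$-algebras with involution whose involutions have the same type, and let $\mathfrak m:\mathrm{Herm}(A,\sigma)\to\mathrm{Herm}(B,\tau)$ be a Morita equivalence of $F$-algebras with involution. That is, $\mathfrak m$ is given by an $A$-$B$-bimodule $N$ on which $F$ acts in the same way from both sides, which is finitely generated over $B$ and for which the left action is an isomorphism $A\cong\mathrm{End}_B(N)$, together with a nonsingular hermitian form $b:N\times N\to B$ over $(B,\tau)$ with $b(ax,y)=b(x,\sigma(a)y)$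 for all $a\in A$ and $x,y\in N$; it sends $(M,h)$ to $M\otimes_AN$ with the form $(x\otimes n,x'\otimes n')\mapsto b(n,h(x,x')n')$. Put $$\mathfrak m_*(\mathscr P):=\bigcup\{D_{(B,\tau)}(\mathfrak m(h))\mid h\in\mathrm{Diag}(\mathscr P)\}.$$ Then: (1) $\mathfrak m_*$ is a bijection from $Y_{(A,\sigma)}$ to $Y_{(B,\tau)}$; (2) it preserves inclusions in both directions: for $\mathscr P,\mathscr Q\in Y_{(A,\sigma)}$ one has $\mathscr P\subseteq\mathscr Q$ if and only if $\mathfrak m_*(\mathscr P)\subseteq\mathfrak m_*(\mathscr Q)$; (3) it restricts to a bijection from $X_{(A,\sigma)}$ to $X_{(B,\tau)}$; (4) if $\mathscr P\in Y_{(A,\sigma)}$ is over an ordering $P$ of $F$, then $\mathfrak m_*(\mathscr P)$ is also over $P$. -/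

import Mathlib

open scoped TensorProduct
open MulOpposite

universe u v w t

namespace PosCone

/-! ### Algebras with involution

The involution of a ring `A` is Mathlib's `star`, and `Sym(A, σ)` is the set of all `a : A` with
`IsSelfAdjoint a`. Right `A`-modules are modules over `Aᵐᵒᵖ`. -/

/-- `(A, star)` is an `F`-algebra with involution: `A` is a finite-dimensional simple `F`-algebra
and `F = Z(A) ∩ Sym(A, star)`. -/
class IsAlgebraWithInvolution (F : Type*) (A : Type*) [Field F] [Ring A] [Algebra F A]
    [StarRing A] : Prop where
  finiteDimensional : FiniteDimensional F A
  isSimpleRing : IsSimpleRing A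
  range_algebraMap :
    Set.range (algebraMap F A) = Set.center A ∩ {a : A | IsSelfAdjoint a}

theorem star_algebraMap (F : Type*) {A : Type*} [Field F] [Ring A] [Algebra F A] [StarRing A]
    [IsAlgebraWithInvolution F A] (c : F) : star (algebraMap F A c) = algebraMap F A c := by
  have h : algebraMap F A c ∈ Set.range (algebraMap F A) := ⟨c, rfl⟩
  rw [IsAlgebraWithInvolution.range_algebraMap] at h
  exact h.2

/-- `Sym(A, star)` as an `F`-subspace of `A`. -/
def symSubspace (F : Type*) (A : Type*) [Field F] [Ring A] [Algebra F A] [StarRing A]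
    [IsAlgebraWithInvolution F A] : Submodule F A where
  carrier := {a | IsSelfAdjoint a}
  add_mem' ha hb := IsSelfAdjoint.add ha hb
  zero_mem' := IsSelfAdjoint.zero A
  smul_mem' c a ha := by
    have ha' : star a = a := ha
    change star (c • a) = c • a
    rw [Algebra.smul_def, star_mul, ha', star_algebraMap F c, Algebra.commutes]

/-- The involution is of the first kind: it is trivial on the centre. -/
def IsFirstKind (A : Type*) [Ring A] [StarRing A] : Prop :=
  ∀ z ∈ Set.center A, star z = z

/-- The involution is of the second kind, i.e. of unitary type. -/
def IsUnitaryType (A : Type*) [Ring A] [StarRing A] : Prop :=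
  ¬ IsFirstKind A

/-- Orthogonal type: first kind and `dim Sym = n (n + 1) / 2`, where `dim A = n ^ 2`. -/
def IsOrthogonalType (F : Type*) (A : Type*) [Field F] [Ring A] [Algebra F A] [StarRing A]
    [IsAlgebraWithInvolution F A] : Prop :=
  IsFirstKind A ∧ ∃ n : ℕ, Module.finrank F A = n ^ 2 ∧
    2 * Module.finrank F (symSubspace F A) = n ^ 2 + n

/-- Symplectic type: first kind and `dim Sym = n (n - 1) / 2`, where `dim A = n ^ 2`. -/
def IsSymplecticType (F : Type*) (A : Type*) [Field F] [Ring A] [Algebra F A] [StarRing A]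
    [IsAlgebraWithInvolution F A] : Prop :=
  IsFirstKind A ∧ ∃ n : ℕ, Module.finrank F A = n ^ 2 ∧
    2 * Module.finrank F (symSubspace F A) + n = n ^ 2

/-- The two involutions have the same type. -/
def SameType (F : Type*) (A B : Type*) [Field F] [Ring A] [Algebra F A] [StarRing A]
    [IsAlgebraWithInvolution F A] [Ring B] [Algebra F B] [StarRing B]
    [IsAlgebraWithInvolution F B] : Prop :=
  (IsOrthogonalType F A ∧ IsOrthogonalType F B) ∨
  (IsSymplecticType F A ∧ IsSymplecticType F B) ∨
  (IsUnitaryType A ∧ IsUnitaryType B)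

/-! ### Hermitian forms -/

/-- A (possibly singular) hermitian form over `(A, star)` on the right `A`-module `M`: it is
biadditive, `h (x a) (y b) = star a * h x y * b` and `star (h x y) = h y x`. -/
structure HermForm (A : Type u) [Ring A] [StarRing A] (M : Type v) [AddCommGroup M]
    [Module Aᵐᵒᵖ M] where
  toFun : M → M → A
  add_right' : ∀ x y z, toFun x (y + z) = toFun x y + toFun x z
  smul_right' : ∀ x y (a : A), toFun x (op a • y) = toFun x y * a
  star_apply' : ∀ x y, star (toFun x y) = toFun y x

namespace HermForm

variable {A : Type u} [Ring A] [StarRing A] {M : Type v} [AddCommGroup M] [Module Aᵐᵒᵖ M]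

instance : CoeFun (HermForm A M) (fun _ => M → M → A) := ⟨HermForm.toFun⟩

variable (h : HermForm A M)

theorem add_right (x y z : M) : h x (y + z) = h x y + h x z := h.add_right' x y z

theorem smul_right (x y : M) (a : A) : h x (op a • y) = h x y * a := h.smul_right' x y a

theorem star_apply (x y : M) : star (h x y) = h y x := h.star_apply' x y

theorem add_left (x y z : M) : h (x + y) z = h x z + h y z := by
  rw [← h.star_apply z (x + y), h.add_right, star_add, h.star_apply, h.star_apply]

theorem smul_left (x y : M) (a : A) : h (op a • x) y = star a * h x y := by
  rw [← h.star_apply y (op a • x), h.smul_right, star_mul, h.star_apply]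

end HermForm

/-- An object of the category `Herm(A, star)`: a finitely generated right `A`-module with a
(possibly singular) hermitian form. -/
structure Herm (A : Type u) [Ring A] [StarRing A] where
  carrier : Type v
  [addCommGroup : AddCommGroup carrier]
  [module : Module Aᵐᵒᵖ carrier]
  [finite : Module.Finite Aᵐᵒᵖ carrier]
  form : HermForm A carrier

attribute [instance] Herm.addCommGroup Herm.module Herm.finite

/-- The set `D(h)` of elements represented by `h`. -/
def Herm.represented {A : Type u} [Ring A] [StarRing A] (h : Herm.{u, v} A) : Set A :=
  {c | IsSelfAdjoint c ∧ ∃ x : h.carrier, h.form x x = c}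

theorem finite_right (A : Type*) [Ring A] : Module.Finite Aᵐᵒᵖ A :=
  ⟨⟨{1}, eq_top_iff.2 fun a _ => by
    rw [Finset.coe_singleton]
    exact Submodule.mem_span_singleton.2 ⟨op a, by simp⟩⟩⟩

/-- The diagonal form `⟨a₁, …, a_k⟩` on `A ^ k`, mapping `(x, y)` to `∑ star (x i) * a i * y i`. -/
def diagForm {A : Type u} [Ring A] [StarRing A] {k : ℕ} (a : Fin k → A)
    (ha : ∀ i, IsSelfAdjoint (a i)) : Herm.{u, u} A where
  carrier := Fin k → A
  finite := haveI := finite_right A; inferInstance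
  form :=
    { toFun := fun x y => ∑ i, star (x i) * a i * y i
      add_right' := fun x y z => by simp [mul_add, Finset.sum_add_distrib]
      smul_right' := fun x y c => by simp [Finset.sum_mul, mul_assoc]
      star_apply' := fun x y => by
        rw [star_sum]
        refine Finset.sum_congr rfl fun i _ => ?_
        rw [star_mul, star_mul, star_star, (ha i).star_eq, mul_assoc] }

/-- `Diag(S)`: the diagonal hermitian forms with coefficients in `S ∩ Sym(A, star)`. -/
def Diag {A : Type u} [Ring A] [StarRing A] (S : Set A) : Set (Herm.{u, u} A) :=
  {h | ∃ (k : ℕ) (a : Fin k → A) (ha : ∀ i, IsSelfAdjoint (a i)),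
    (∀ i, a i ∈ S) ∧ h = diagForm a ha}

/-! ### Prepositive cones -/

/-- `S ⊆ F` is (the set of nonnegative elements of) an ordering of the field `F`. -/
def IsFieldOrdering {F : Type*} [Field F] (S : Set F) : Prop :=
  ∃ O : RingPreordering F, O.IsOrdering ∧ (O : Set F) = S

/-- `P_F = {u ∈ F | u P ⊆ P}`. -/
def coneScalars (F : Type*) {A : Type*} [Field F] [Ring A] [Algebra F A] (P : Set A) : Set F :=
  {u | ∀ p ∈ P, u • p ∈ P}

/-- Prepositive cones on the `F`-algebra with involution `(A, star)`. -/
structure IsPrepositiveCone (F : Type*) {A : Type*} [Field F] [Ring A] [Algebra F A] [StarRing A]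
    (P : Set A) : Prop where
  isSelfAdjoint : ∀ p ∈ P, IsSelfAdjoint p
  nonempty : P.Nonempty
  add_mem : ∀ p ∈ P, ∀ q ∈ P, p + q ∈ P
  conj_mem : ∀ a : A, ∀ p ∈ P, star a * p * a ∈ P
  isFieldOrdering : IsFieldOrdering (coneScalars F P)
  proper : P ∩ {p | -p ∈ P} = {0}

/-- `Y_(A, star)`: the set of all prepositive cones. -/
def prepositiveCones (F : Type*) (A : Type*) [Field F] [Ring A] [Algebra F A] [StarRing A] :
    Set (Set A) :=
  {P | IsPrepositiveCone F P}

/-- `X_(A, star)`: the set of all positive cones, i.e. of the prepositive cones that are maximal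
with respect to inclusion. -/
def positiveCones (F : Type*) (A : Type*) [Field F] [Ring A] [Algebra F A] [StarRing A] :
    Set (Set A) :=
  {P | Maximal (fun Q : Set A => IsPrepositiveCone F Q) P}

/-! ### Morita equivalences of algebras with involution -/

/-- A Morita equivalence from `(A, star)` to `(B, star)` over `F`, for hermitian forms: an
`A`-`B`-bimodule `N` on which `F` acts in the same way from both sides, finitely generated over
`B`, such that the left action identifies `A` with `End_B(N)`, together with a nonsingular
hermitian form `b : N × N → B` whose adjoint involution on `A = End_B(N)` is `star`. (`B` being
simple artinian, a nonzero finitely generated module `N` is automatically a progenerator.) -/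
structure MoritaEquiv (F : Type*) (A : Type u) (B : Type v) [Field F] [Ring A] [Algebra F A]
    [StarRing A] [Ring B] [Algebra F B] [StarRing B] where
  N : Type w
  [addCommGroup : AddCommGroup N]
  [leftModule : Module A N]
  [rightModule : Module Bᵐᵒᵖ N]
  [smulComm : SMulCommClass A Bᵐᵒᵖ N]
  [finite : Module.Finite Bᵐᵒᵖ N]
  algebraMap_smul : ∀ (c : F) (n : N), algebraMap F A c • n = op (algebraMap F B c) • n
  end_bijective : ∀ f : N →ₗ[Bᵐᵒᵖ] N, ∃! a : A, ∀ n, f n = a • n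
  b : HermForm B N
  nonsingular : ∀ f : N →ₗ[Bᵐᵒᵖ] B, ∃! x : N, ∀ y, f y = b x y
  adjoint : ∀ (a : A) (x y : N), b (a • x) y = b x (star a • y)

attribute [instance] MoritaEquiv.addCommGroup MoritaEquiv.leftModule MoritaEquiv.rightModule
  MoritaEquiv.smulComm MoritaEquiv.finite

/-- A biadditive map as a `ℤ`-bilinear map. -/
def biadditive {X Y Z : Type*} [AddCommGroup X] [AddCommGroup Y] [AddCommGroup Z]
    (f : X → Y → Z) (h₁ : ∀ x x' y, f (x + x') y = f x y + f x' y)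
    (h₂ : ∀ x y y', f x (y + y') = f x y + f x y') : X →ₗ[ℤ] Y →ₗ[ℤ] Z :=
  LinearMap.mk₂ ℤ f h₁ (fun c x y => map_zsmul (AddMonoidHom.mk' (f · y) fun x x' => h₁ x x' y) c x)
    h₂ (fun c x y => map_zsmul (AddMonoidHom.mk' (f x) fun y y' => h₂ x y y') c y)

@[simp]
theorem biadditive_apply {X Y Z : Type*} [AddCommGroup X] [AddCommGroup Y] [AddCommGroup Z]
    (f : X → Y → Z) (h₁ : ∀ x x' y, f (x + x') y = f x y + f x' y)
    (h₂ : ∀ x y y', f x (y + y') = f x y + f x y') (x : X) (y : Y) :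
    biadditive f h₁ h₂ x y = f x y := rfl

namespace MoritaEquiv

variable {F : Type*} {A : Type u} {B : Type v} [Field F] [Ring A] [Algebra F A]
    [StarRing A] [Ring B] [Algebra F B] [StarRing B] (m : MoritaEquiv.{u, v, w} F A B)

section tensor

variable (M : Type*) [AddCommGroup M] [Module Aᵐᵒᵖ M]

/-- The relations `m a ⊗ n = m ⊗ a n` defining `M ⊗_A N`. The two factors are written in the order
`N ⊗ M`, so that the right `B`-action of `N` is Mathlib's action on the first factor. -/
def relations : Submodule Bᵐᵒᵖ (m.N ⊗[ℤ] M) :=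
  Submodule.span Bᵐᵒᵖ {z | ∃ (a : A) (n : m.N) (x : M),
    z = (a • n) ⊗ₜ[ℤ] x - n ⊗ₜ[ℤ] (op a • x)}

/-- The right `B`-module `M ⊗_A N`. -/
abbrev Tensor : Type _ := (m.N ⊗[ℤ] M) ⧸ m.relations M

/-- The element `x ⊗ n` of `M ⊗_A N`. -/
def tmul {M : Type*} [AddCommGroup M] [Module Aᵐᵒᵖ M] (x : M) (n : m.N) : m.Tensor M :=
  (m.relations M).mkQ (n ⊗ₜ[ℤ] x)

theorem tmul_smul_left {M : Type*} [AddCommGroup M] [Module Aᵐᵒᵖ M] (x : M) (a : A) (n : m.N) :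
    m.tmul (op a • x) n = m.tmul x (a • n) := by
  symm
  refine (Submodule.Quotient.eq _).2 (Submodule.subset_span ⟨a, n, x, rfl⟩)

end tensor

section form

variable {M : Type*} [AddCommGroup M] [Module Aᵐᵒᵖ M] (h : HermForm A M)

/-- The biadditive map `(n ⊗ x, n' ⊗ x') ↦ b (n, h (x, x') n')` before passing to `M ⊗_A N`. -/
def preForm : (m.N ⊗[ℤ] M) →ₗ[ℤ] (m.N ⊗[ℤ] M) →ₗ[ℤ] B :=
  TensorProduct.lift <| biadditive
    (fun n x => TensorProduct.lift <| biadditive (fun n' x' => m.b n (h x x' • n'))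
      (fun n₁ n₂ x' => by rw [smul_add, m.b.add_right])
      (fun n' x₁ x₂ => by rw [h.add_right, add_smul, m.b.add_right]))
    (fun n₁ n₂ x => by
      refine TensorProduct.ext' fun n' x' => ?_
      exact m.b.add_left n₁ n₂ (h x x' • n'))
    (fun n x₁ x₂ => by
      refine TensorProduct.ext' fun n' x' => ?_
      change m.b n (h (x₁ + x₂) x' • n') = m.b n (h x₁ x' • n') + m.b n (h x₂ x' • n')
      rw [h.add_left, add_smul, m.b.add_right])

@[simp]
theorem preForm_tmul (n n' : m.N) (x x' : M) :
    m.preForm h (n ⊗ₜ x) (n' ⊗ₜ x') = m.b n (h x x' • n') := rfl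

theorem preForm_star (z z' : m.N ⊗[ℤ] M) :
    star (m.preForm h z z') = m.preForm h z' z := by
  induction z using TensorProduct.induction_on with
  | zero => simp
  | add z₁ z₂ h₁ h₂ => simp [h₁, h₂]
  | tmul n x =>
    induction z' using TensorProduct.induction_on with
    | zero => simp
    | add z₁ z₂ h₁ h₂ => simp [h₁, h₂]
    | tmul n' x' =>
      rw [preForm_tmul, preForm_tmul, m.b.star_apply, m.adjoint, h.star_apply]

theorem preForm_smul_right (z z' : m.N ⊗[ℤ] M) (c : B) :
    m.preForm h z (op c • z') = m.preForm h z z' * c := by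
  induction z using TensorProduct.induction_on with
  | zero => simp
  | add z₁ z₂ h₁ h₂ => simp [h₁, h₂, add_mul]
  | tmul n x =>
    induction z' using TensorProduct.induction_on with
    | zero => simp
    | add z₁ z₂ h₁ h₂ => simp [h₁, h₂, add_mul]
    | tmul n' x' =>
      rw [TensorProduct.smul_tmul', preForm_tmul, preForm_tmul, smul_comm, m.b.smul_right]

theorem preForm_right_eq_zero (z : m.N ⊗[ℤ] M) {z' : m.N ⊗[ℤ] M} (hz' : z' ∈ m.relations M) :
    m.preForm h z z' = 0 := by
  refine Submodule.span_induction ?_ (by simp) (fun x y _ _ hx hy => by simp [hx, hy])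
    (fun c x _ hx => by
      have := m.preForm_smul_right h z x c.unop
      rw [op_unop] at this
      rw [this, hx, zero_mul]) hz'
  rintro _ ⟨a, n', x', rfl⟩
  induction z using TensorProduct.induction_on with
  | zero => simp
  | add z₁ z₂ h₁ h₂ =>
    rw [map_add, LinearMap.add_apply, h₁, h₂, add_zero]
  | tmul n x =>
    rw [map_sub, preForm_tmul, preForm_tmul, h.smul_right, mul_smul, sub_self]

theorem preForm_left_eq_zero {z : m.N ⊗[ℤ] M} (hz : z ∈ m.relations M) (z' : m.N ⊗[ℤ] M) :
    m.preForm h z z' = 0 := by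
  rw [← m.preForm_star, m.preForm_right_eq_zero h z' hz, star_zero]

/-- The hermitian form on `M ⊗_A N` with `(x ⊗ n, x' ⊗ n') ↦ b (n, h (x, x') n')`. -/
def tensorForm : HermForm B (m.Tensor M) where
  toFun := fun p q => Quotient.liftOn₂' p q (fun z z' => m.preForm h z z') (by
    intro z₁ z₁' z₂ z₂' hz hz'
    rw [Submodule.quotientRel_def] at hz hz'
    have e₁ := m.preForm_left_eq_zero h hz z₁'
    have e₂ := m.preForm_right_eq_zero h z₂ hz'
    rw [map_sub, LinearMap.sub_apply, sub_eq_zero] at e₁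
    rw [map_sub, sub_eq_zero] at e₂
    exact e₁.trans e₂)
  add_right' := by
    rintro ⟨x⟩ ⟨y⟩ ⟨z⟩
    exact map_add (m.preForm h x) y z
  smul_right' := by
    rintro ⟨x⟩ ⟨y⟩ c
    exact m.preForm_smul_right h x y c
  star_apply' := by
    rintro ⟨x⟩ ⟨y⟩
    exact m.preForm_star h x y

theorem tensorForm_tmul (x x' : M) (n n' : m.N) :
    m.tensorForm h (m.tmul x n) (m.tmul x' n') = m.b n (h x x' • n') := rfl

end form

theorem tensor_finite (M : Type*) [AddCommGroup M] [Module Aᵐᵒᵖ M] [Module.Finite Aᵐᵒᵖ M] :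
    Module.Finite Bᵐᵒᵖ (m.Tensor M) := by
  classical
  obtain ⟨S, hS⟩ := Module.Finite.fg_top (R := Bᵐᵒᵖ) (M := m.N)
  obtain ⟨T, hT⟩ := Module.Finite.fg_top (R := Aᵐᵒᵖ) (M := M)
  refine ⟨⟨(T ×ˢ S).image fun p => m.tmul p.1 p.2, eq_top_iff.2 ?_⟩⟩
  set W := Submodule.span Bᵐᵒᵖ ((((T ×ˢ S).image fun p => m.tmul p.1 p.2 : Finset (m.Tensor M))) :
    Set (m.Tensor M)) with hW
  have h₁ : ∀ t ∈ T, ∀ n : m.N, m.tmul t n ∈ W := by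
    intro t ht n
    have hn : n ∈ Submodule.span Bᵐᵒᵖ (S : Set m.N) := hS ▸ Submodule.mem_top
    induction hn using Submodule.span_induction with
    | mem s hs =>
      exact Submodule.subset_span (Finset.mem_coe.2 (Finset.mem_image.2
        ⟨(t, s), Finset.mem_product.2 ⟨ht, hs⟩, rfl⟩))
    | zero => simp [tmul]
    | add x y _ _ hx hy =>
      have : m.tmul t (x + y) = m.tmul t x + m.tmul t y := by
        simp only [tmul, TensorProduct.add_tmul, map_add]
      exact this ▸ W.add_mem hx hy
    | smul c x _ hx =>
      have : m.tmul t (c • x) = c • m.tmul t x := by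
        simp only [tmul, ← TensorProduct.smul_tmul', map_smul]
      exact this ▸ W.smul_mem c hx
  have h₂ : ∀ (x : M) (n : m.N), m.tmul x n ∈ W := by
    intro x
    have hx : x ∈ Submodule.span Aᵐᵒᵖ (T : Set M) := hT ▸ Submodule.mem_top
    induction hx using Submodule.span_induction with
    | mem t ht => exact h₁ t ht
    | zero => intro n; simp [tmul]
    | add x y _ _ hx hy =>
      intro n
      have : m.tmul (x + y) n = m.tmul x n + m.tmul y n := by
        simp only [tmul, TensorProduct.tmul_add, map_add]
      exact this ▸ W.add_mem (hx n) (hy n)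
    | smul c x _ hx =>
      intro n
      have := m.tmul_smul_left x c.unop n
      rw [op_unop] at this
      exact this ▸ hx _
  intro z _
  obtain ⟨z, rfl⟩ := (m.relations M).mkQ_surjective z
  induction z using TensorProduct.induction_on with
  | zero => simp
  | add z₁ z₂ h₁ h₂ => rw [map_add]; exact W.add_mem (h₁ trivial) (h₂ trivial)
  | tmul n x => exact h₂ x n

/-- The functor `𝔪 : Herm(A, star) → Herm(B, star)` on objects, `(M, h) ↦ (M ⊗_A N, b h)`. -/
def obj (h : Herm.{u, t} A) : Herm.{v, max t w} B :=
  haveI := m.tensor_finite h.carrier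
  { carrier := m.Tensor h.carrier
    form := m.tensorForm h.form }

/-- `𝔪_*(P) = ⋃ {D(𝔪(h)) | h ∈ Diag(P)}`. -/
def mapCone (P : Set A) : Set B :=
  ⋃ h ∈ Diag P, (m.obj h).represented

end MoritaEquiv

end PosCone

open PosCone

/-! The rank one maps `z ↦ x b(y, z)` of `N` are elements `r(x, y)` of `A = End_B(N)` with
`r(x, y)* = r(y, x)`, and they form a nonsingular hermitian form over `A` on the conjugate bimodule
of `N`. Simplicity of `B` makes this bimodule a Morita equivalence from `B` to `A`, so it suffices
to show that `𝔪_*` maps cones to cones and that the conjugate bimodule undoes it.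

As `𝔪_*(P)` is the additive monoid generated by the elements `b(n, p n)` with `p ∈ P`, going there
and back produces sums of the elements `r(k, n) p r(n, k)`, which lie in `P`. Conversely, let
`0 ≠ p ∈ P`. Some `c = b(n, p n)` is nonzero, and if `d` is a self-adjoint generalized inverse of
`c`, then `e = r(n d, p n)` is an idempotent that is self-adjoint with respect to `p`. The summand
`p e` of `p = p e + p (1 - e)` comes back from `c`, and `p (1 - e) = (1 - e)* p (1 - e)` lies in
`P` and generates a smaller left ideal, so the descending chain condition ends the argument. -/

namespace PosCone

theorem bijOn_setOf_maximal {α β : Type*} [Preorder α] [Preorder β] {f : α → β} {s : Set α}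
    {t : Set β} (hf : Set.BijOn f s t) (hle : ∀ x ∈ s, ∀ y ∈ s, f x ≤ f y ↔ x ≤ y) :
    Set.BijOn f {x | Maximal (· ∈ s) x} {y | Maximal (· ∈ t) y} := by
  have himage := image_monotone_setOfPred_maximal_mem fun x y hx hy => hle x hx y hy
  rw [hf.image_eq] at himage
  exact himage ▸ (hf.injOn.mono fun x hx => hx.prop).bijOn_image

theorem exists_mul_mul_eq_self {R : Type*} [Ring R] [IsSemisimpleRing R] (c : R) :
    ∃ y, c * y * c = c := by
  obtain ⟨e, he, hspan⟩ := IsSemisimpleRing.ideal_eq_span_idempotent (Ideal.span {c})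
  obtain ⟨y, hy⟩ := Ideal.mem_span_singleton'.1 (hspan ▸ Ideal.mem_span_singleton_self e)
  obtain ⟨z, hz⟩ := Ideal.mem_span_singleton'.1 (hspan ▸ Ideal.mem_span_singleton_self c)
  refine ⟨y, ?_⟩
  rw [mul_assoc, hy, ← hz, mul_assoc, he.eq]

theorem exists_isSelfAdjoint_generalizedInverse {R : Type*} [Ring R] [StarRing R]
    [IsSemisimpleRing R] {c : R} (hc : IsSelfAdjoint c) :
    ∃ d, IsSelfAdjoint d ∧ d * c * d = d ∧ c * d * c = c := by
  obtain ⟨y, hy⟩ := exists_mul_mul_eq_self c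
  have hy' : c * star y * c = c := by
    simpa only [star_mul, hc.star_eq, mul_assoc] using congrArg star hy
  refine ⟨star y * c * y, hc.conjugate' y, ?_, ?_⟩
  · calc star y * c * y * c * (star y * c * y)
      _ = star y * (c * y * c) * star y * c * y := by noncomm_ring
      _ = star y * (c * star y * c) * y := by rw [hy]; noncomm_ring
      _ = star y * c * y := by rw [hy']
  · calc c * (star y * c * y) * c
      _ = c * star y * (c * y * c) := by noncomm_ring
      _ = c := by rw [hy, hy']

namespace HermForm

variable {A : Type*} [Ring A] [StarRing A] {M : Type*} [AddCommGroup M] [Module Aᵐᵒᵖ M]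
  (h : HermForm A M)

theorem sum_right {ι : Type*} (s : Finset ι) (x : M) (f : ι → M) :
    h x (∑ i ∈ s, f i) = ∑ i ∈ s, h x (f i) :=
  map_sum (AddMonoidHom.mk' (h x) (h.add_right x)) f s

theorem sum_left {ι : Type*} (s : Finset ι) (f : ι → M) (y : M) :
    h (∑ i ∈ s, f i) y = ∑ i ∈ s, h (f i) y :=
  map_sum (AddMonoidHom.mk' (h · y) fun x x' => h.add_left x x' y) f s

theorem zero_right (x : M) : h x 0 = 0 := by
  simpa only [Finset.sum_empty] using h.sum_right ∅ x id

theorem neg_right (x y : M) : h x (-y) = -h x y :=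
  map_neg (AddMonoidHom.mk' (h x) (h.add_right x)) y

/-- The left ideal generated by the values of a hermitian form; it is two-sided. -/
def valueIdeal : Ideal A :=
  Ideal.span {c | ∃ x y, h x y = c}

instance : h.valueIdeal.IsTwoSided := by
  refine ⟨fun {c} a hc => ?_⟩
  induction hc using Submodule.span_induction with
  | mem c hc =>
    obtain ⟨x, y, rfl⟩ := hc
    exact Ideal.subset_span ⟨x, op a • y, h.smul_right x y a⟩
  | zero => simp only [zero_mul, zero_mem]
  | add c d _ _ hc hd => simpa only [add_mul] using add_mem hc hd
  | smul r c _ hc => simpa only [smul_eq_mul, mul_assoc] using Ideal.mul_mem_left _ r hc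

variable {h}

theorem valueIdeal_eq_top [IsSimpleRing A] {x y : M} (hxy : h x y ≠ 0) : h.valueIdeal = ⊤ :=
  ((isSimpleRing_iff_isTwoSided_imp.1 ‹_›).2 h.valueIdeal inferInstance).resolve_left
    fun hbot => hxy (Ideal.mem_bot.1 (hbot ▸ Ideal.subset_span ⟨x, y, rfl⟩))

theorem exists_sum_eq_one [IsSimpleRing A] {x y : M} (hxy : h x y ≠ 0) :
    ∃ (k : ℕ) (u v : Fin k → M), ∑ i, h (u i) (v i) = 1 := by
  have hone : (1 : A) ∈ h.valueIdeal := valueIdeal_eq_top hxy ▸ Submodule.mem_top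
  obtain ⟨k, r, c, hsum⟩ := Submodule.mem_span_set'.1 hone
  choose u v huv using fun i => (c i).2
  refine ⟨k, fun i => op (star (r i)) • u i, v, ?_⟩
  simpa only [h.smul_left, star_star, huv, smul_eq_mul] using hsum

theorem exists_apply_self_ne_zero [IsSimpleRing A] (h2 : (2 : A) ≠ 0) {x y : M}
    (hxy : h x y ≠ 0) : ∃ z, h z z ≠ 0 := by
  by_contra! halt
  have hskew (z w : M) : h w z = -h z w := by
    have := halt (z + w)
    rw [h.add_left, h.add_right, h.add_right, halt, halt, zero_add, add_zero] at this
    exact (neg_eq_of_add_eq_zero_right this).symm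
  obtain ⟨k, u, v, huv⟩ := exists_sum_eq_one hxy
  have hone : (1 : A) = -1 := by
    calc (1 : A) = star (∑ i, h (u i) (v i)) := by rw [huv, star_one]
      _ = ∑ i, -h (u i) (v i) := by simp only [star_sum, h.star_apply, ← hskew]
      _ = -1 := by rw [Finset.sum_neg_distrib, huv]
  rw [eq_neg_iff_add_eq_zero, one_add_one_eq_two] at hone
  exact h2 hone

end HermForm

theorem diagForm_single {A : Type*} [Ring A] [StarRing A] {k : ℕ} {a : Fin k → A}
    (ha : ∀ i, IsSelfAdjoint (a i)) (i j : Fin k) :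
    (diagForm a ha).form (Pi.single i 1) (Pi.single j 1) = if i = j then a i else 0 := by
  change ∑ l, star ((Pi.single i 1 : Fin k → A) l) * a l * (Pi.single j 1 : Fin k → A) l = _
  rw [Finset.sum_eq_single j]
  · rcases eq_or_ne i j with rfl | hij
    · simp only [Pi.single_eq_same, star_one, one_mul, mul_one, if_true]
    · simp only [Pi.single_eq_of_ne' hij, star_zero, zero_mul, if_neg hij]
  · intro l _ hlj
    rw [Pi.single_eq_of_ne hlj, mul_zero]
  · exact fun hj => absurd (Finset.mem_univ j) hj

namespace IsPrepositiveCone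

variable {F A : Type*} [Field F] [Ring A] [Algebra F A] [StarRing A] {P : Set A}

theorem zero_mem (hP : IsPrepositiveCone F P) : 0 ∈ P :=
  (hP.proper.symm ▸ Set.mem_singleton (0 : A) : (0 : A) ∈ P ∩ {p | -p ∈ P}).1

theorem eq_zero_of_neg_mem (hP : IsPrepositiveCone F P) {p : A} (hp : p ∈ P) (hp' : -p ∈ P) :
    p = 0 :=
  Set.mem_singleton_iff.1 (hP.proper ▸ ⟨hp, hp'⟩)

theorem two_ne_zero (hP : IsPrepositiveCone F P) (R : Type*) [Ring R] [Nontrivial R]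
    [Algebra F R] : (2 : R) ≠ 0 := by
  obtain ⟨O, _, -⟩ := hP.isFieldOrdering
  have hF : (2 : F) ≠ 0 := fun h2 => O.neg_one_notMem <| by
    rw [← one_add_one_eq_two, add_eq_zero_iff_neg_eq] at h2
    rw [h2]
    exact one_mem O
  rw [← map_ofNat (algebraMap F R)]
  exact (map_ne_zero _).2 hF

end IsPrepositiveCone

namespace MoritaEquiv

variable {F : Type*} {A : Type u} {B : Type v} [Field F] [Ring A] [Algebra F A] [StarRing A]
  [Ring B] [Algebra F B] [StarRing B] (m : MoritaEquiv.{u, v, w} F A B)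

section rankOne

theorem smul_ext {a a' : A} (h : ∀ n : m.N, a • n = a' • n) : a = a' :=
  (m.end_bijective (DistribSMul.toLinearMap Bᵐᵒᵖ m.N a)).unique (fun _ => rfl) h

variable {m} in
theorem eq_of_forall_b_left_eq {x x' : m.N} (h : ∀ y, m.b x y = m.b x' y) : x = x' := by
  refine (m.nonsingular ⟨⟨m.b x, m.b.add_right x⟩, fun c y => ?_⟩).unique (fun _ => rfl) h
  exact m.b.smul_right x y c.unop

variable {m} in
theorem eq_of_forall_b_right_eq {x x' : m.N} (h : ∀ y, m.b y x = m.b y x') : x = x' :=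
  eq_of_forall_b_left_eq fun y => by rw [← m.b.star_apply, h, m.b.star_apply]

theorem exists_b_ne_zero [Nontrivial A] : ∃ x y, m.b x y ≠ 0 := by
  by_contra! hzero
  have hN (n : m.N) : n = 0 := eq_of_forall_b_right_eq fun y => by rw [hzero, hzero]
  exact one_ne_zero (α := A) (m.smul_ext fun n => by rw [hN n, smul_zero, smul_zero])

theorem exists_sum_b_eq_one [Nontrivial A] [IsSimpleRing B] :
    ∃ (k : ℕ) (u v : Fin k → m.N), ∑ i, m.b (u i) (v i) = 1 :=
  have ⟨_, _, hxy⟩ := m.exists_b_ne_zero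
  HermForm.exists_sum_eq_one hxy

/-- The element of `A = End_B(N)` acting as the rank one operator `z ↦ x b(y, z)`. -/
noncomputable def rankOne (x y : m.N) : A :=
  (m.end_bijective
    { toFun := fun z => op (m.b y z) • x
      map_add' := fun z z' => by rw [m.b.add_right, op_add, add_smul]
      map_smul' := fun c z => by
        rw [← op_unop c, m.b.smul_right, op_mul, mul_smul, RingHom.id_apply] }).choose

theorem rankOne_smul (x y z : m.N) : m.rankOne x y • z = op (m.b y z) • x :=
  ((m.end_bijective _).choose_spec.1 z).symm

theorem rankOne_add_right (x y y' : m.N) :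
    m.rankOne x (y + y') = m.rankOne x y + m.rankOne x y' :=
  m.smul_ext fun z => by
    simp only [rankOne_smul, add_smul, m.b.add_left, op_add]

theorem star_rankOne (x y : m.N) : star (m.rankOne x y) = m.rankOne y x :=
  m.smul_ext fun z => eq_of_forall_b_right_eq fun w => by
    rw [← m.adjoint, rankOne_smul, rankOne_smul, m.b.smul_left, m.b.smul_right, m.b.star_apply]

theorem mul_rankOne (a : A) (x y : m.N) : a * m.rankOne x y = m.rankOne (a • x) y :=
  m.smul_ext fun z => by rw [mul_smul, rankOne_smul, rankOne_smul, smul_comm]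

theorem rankOne_mul (x y : m.N) (a : A) : m.rankOne x y * a = m.rankOne x (star a • y) := by
  rw [← star_rankOne, ← star_star a, ← star_mul, mul_rankOne, star_rankOne, star_star]

theorem rankOne_mul_rankOne (x y z w : m.N) :
    m.rankOne x y * m.rankOne z w = m.rankOne (op (m.b y z) • x) w := by
  rw [mul_rankOne, rankOne_smul]

theorem rankOne_op_smul_right (x y : m.N) (c : B) :
    m.rankOne x (op c • y) = m.rankOne (op (star c) • x) y :=
  m.smul_ext fun z => by rw [rankOne_smul, rankOne_smul, m.b.smul_left, op_mul, mul_smul]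

theorem op_smul_ext [Nontrivial A] [IsSimpleRing B] {c c' : B}
    (h : ∀ n : m.N, op c • n = op c' • n) : c = c' := by
  obtain ⟨k, u, v, huv⟩ := m.exists_sum_b_eq_one
  calc c = ∑ i, m.b (u i) (op c • v i) := by
        simp only [m.b.smul_right, ← Finset.sum_mul, huv, one_mul]
    _ = ∑ i, m.b (u i) (op c' • v i) := by simp only [h]
    _ = c' := by simp only [m.b.smul_right, ← Finset.sum_mul, huv, one_mul]

variable {m}

theorem star_algebraMap_smul (c : F) (n : m.N) :
    star (algebraMap F A c) • n = op (star (algebraMap F B c)) • n :=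
  eq_of_forall_b_right_eq fun x => by
    rw [← m.adjoint, m.algebraMap_smul, m.b.smul_left, m.b.smul_right, ← m.b.star_apply,
      ← star_mul, ← star_mul, Algebra.commutes]

end rankOne

section symm

/-- The conjugate bimodule of `N`: the group `N` on which `B` acts from the left and `A` from
the right through the involutions. -/
def Conj : Type w := m.N

instance : AddCommGroup m.Conj := inferInstanceAs (AddCommGroup m.N)

/-- The identity map from the conjugate bimodule to `N`. -/
def ofConj : m.Conj ≃+ m.N := AddEquiv.refl m.N

instance : Module B m.Conj :=
  Module.compHom m.N (starRingEquiv : B ≃+* Bᵐᵒᵖ).toRingHom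

instance : Module Aᵐᵒᵖ m.Conj :=
  Module.compHom m.N (starRingEquiv : A ≃+* Aᵐᵒᵖ).symm.toRingHom

theorem ofConj_smul (c : B) (n : m.Conj) : m.ofConj (c • n) = op (star c) • m.ofConj n := rfl

theorem ofConj_op_smul (a : A) (n : m.Conj) : m.ofConj (op a • n) = star a • m.ofConj n := rfl

instance : SMulCommClass B Aᵐᵒᵖ m.Conj where
  smul_comm c a n := m.ofConj.injective (smul_comm (star a.unop) (op (star c)) (m.ofConj n)).symm

/-- The hermitian form over `A` on the conjugate bimodule given by rank one operators. -/
noncomputable def conjForm : HermForm A m.Conj where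
  toFun x y := m.rankOne (m.ofConj x) (m.ofConj y)
  add_right' _ _ _ := m.rankOne_add_right _ _ _
  smul_right' _ _ _ := (m.rankOne_mul _ _ _).symm
  star_apply' _ _ := m.star_rankOne _ _

theorem conjForm_apply (x y : m.Conj) :
    m.conjForm x y = m.rankOne (m.ofConj x) (m.ofConj y) := rfl

variable [Nontrivial A] [IsSimpleRing B]

theorem exists_sum_op_conjForm_smul :
    ∃ (k : ℕ) (u v : Fin k → m.Conj), ∀ n, ∑ i, op (m.conjForm (u i) n) • v i = n := by
  obtain ⟨k, u, v, huv⟩ := m.exists_sum_b_eq_one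
  refine ⟨k, m.ofConj.symm ∘ u, m.ofConj.symm ∘ v, fun n => m.ofConj.injective ?_⟩
  simp only [map_sum, ofConj_op_smul, conjForm_apply, star_rankOne, rankOne_smul,
    Function.comp_apply, AddEquiv.apply_symm_apply, ← Finset.sum_smul, ← Finset.op_sum, huv,
    op_one, one_smul]

instance : Module.Finite Aᵐᵒᵖ m.Conj := by
  obtain ⟨k, u, v, huv⟩ := m.exists_sum_op_conjForm_smul
  exact Module.Finite.of_surjective (Fintype.linearCombination Aᵐᵒᵖ v)
    fun n => ⟨fun i => op (m.conjForm (u i) n), huv n⟩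

theorem conj_end_bijective (f : m.Conj →ₗ[Aᵐᵒᵖ] m.Conj) : ∃! c : B, ∀ n, f n = c • n := by
  obtain ⟨k, u, v, huv⟩ := m.exists_sum_op_conjForm_smul
  have hf (n : m.Conj) : f n = star (∑ i, m.b (m.ofConj (u i)) (m.ofConj (f (v i)))) • n := by
    apply m.ofConj.injective
    calc m.ofConj (f n) = m.ofConj (∑ i, op (m.conjForm (u i) n) • f (v i)) := by
          rw [← congrArg f (huv n), map_sum]
          simp only [map_smul]
      _ = m.ofConj (star (∑ i, m.b (m.ofConj (u i)) (m.ofConj (f (v i)))) • n) := by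
          simp only [map_sum, ofConj_op_smul, ofConj_smul, conjForm_apply, star_rankOne, star_star,
            rankOne_smul, ← Finset.sum_smul, ← Finset.op_sum]
  refine ⟨_, hf, fun c hc => star_injective (m.op_smul_ext fun n => ?_)⟩
  exact congrArg m.ofConj ((hc (m.ofConj.symm n)).symm.trans (hf _))

theorem conjForm_nonsingular (f : m.Conj →ₗ[Aᵐᵒᵖ] A) : ∃! x, ∀ y, f y = m.conjForm x y := by
  obtain ⟨k, u, v, huv⟩ := m.exists_sum_op_conjForm_smul
  refine existsUnique_of_exists_of_unique ⟨∑ i, op (star (f (v i))) • u i, fun y => ?_⟩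
    fun x x' hx hx' => ?_
  · calc f y = f (∑ i, op (m.conjForm (u i) y) • v i) := by rw [huv]
      _ = m.conjForm (∑ i, op (star (f (v i))) • u i) y := by
          simp only [map_sum, map_smul, op_smul_eq_mul, HermForm.sum_left, HermForm.smul_left,
            star_star]
  · rw [← huv x, ← huv x']
    simp only [← m.conjForm.star_apply x, ← m.conjForm.star_apply x', ← hx, ← hx']

/-- The inverse Morita equivalence, given by the conjugate bimodule with its rank one form. -/
noncomputable def symm : MoritaEquiv.{v, u, w} F B A where
  N := m.Conj
  algebraMap_smul c n := m.ofConj.injective (m.star_algebraMap_smul c (m.ofConj n)).symm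
  end_bijective := m.conj_end_bijective
  b := m.conjForm
  nonsingular := m.conjForm_nonsingular
  adjoint c x y := by
    rw [conjForm_apply, conjForm_apply, ofConj_smul, ofConj_smul, star_star, rankOne_op_smul_right]

theorem symm_b_smul (c : B) (k : m.symm.N) :
    m.symm.b k (c • k) = m.rankOne (m.ofConj k) (op (star c) • m.ofConj k) := rfl

theorem symm_b_b_smul (a : A) (n : m.N) (k : m.symm.N) :
    m.symm.b k (m.b n (a • n) • k) =
      star (m.rankOne n (m.ofConj k)) * a * m.rankOne n (m.ofConj k) := by
  rw [symm_b_smul, rankOne_op_smul_right, star_star, star_rankOne, rankOne_mul,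
    rankOne_mul_rankOne, m.adjoint, star_star]

theorem symm_rankOne (x y : m.symm.N) :
    m.symm.rankOne x y = m.b (m.ofConj x) (m.ofConj y) := by
  refine star_injective (m.op_smul_ext fun z => ?_)
  calc op (star (m.symm.rankOne x y)) • z
    _ = star (m.rankOne (m.ofConj y) z) • m.ofConj x :=
      congrArg m.ofConj (m.symm.rankOne_smul x y (m.ofConj.symm z))
    _ = op (star (m.b (m.ofConj x) (m.ofConj y))) • z := by
      rw [star_rankOne, rankOne_smul, m.b.star_apply]

end symm

section mapCone

theorem exists_eq_sum_tmul_single {k : ℕ} (z : m.Tensor (Fin k → A)) :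
    ∃ n : Fin k → m.N, z = ∑ i, m.tmul (Pi.single i 1) (n i) := by
  obtain ⟨z, rfl⟩ := (m.relations _).mkQ_surjective z
  induction z using TensorProduct.induction_on with
  | zero => exact ⟨0, by simp only [tmul, Pi.zero_apply, TensorProduct.zero_tmul, map_zero,
      Finset.sum_const_zero]⟩
  | add z z' hz hz' =>
    obtain ⟨n, hn⟩ := hz
    obtain ⟨n', hn'⟩ := hz'
    refine ⟨n + n', ?_⟩
    simp only [map_add, hn, hn', ← Finset.sum_add_distrib, tmul, Pi.add_apply,
      TensorProduct.add_tmul]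
  | tmul n x =>
    refine ⟨fun i => x i • n, ?_⟩
    have hx : x = ∑ i, op (x i) • Pi.single i (1 : A) := by
      simpa only [← Pi.single_smul, op_smul_eq_mul, one_mul] using
        (Finset.univ_sum_single x).symm
    calc m.tmul x n = ∑ i, m.tmul (op (x i) • Pi.single i 1) n := by
          conv_lhs => rw [hx]
          simp only [tmul, TensorProduct.tmul_sum, map_sum]
      _ = ∑ i, m.tmul (Pi.single i 1) (x i • n) := by simp only [tmul_smul_left]

theorem tensorForm_diagForm_single {k : ℕ} {a : Fin k → A} (ha : ∀ i, IsSelfAdjoint (a i))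
    (n : Fin k → m.N) (i j : Fin k) :
    m.tensorForm (diagForm a ha).form (m.tmul (Pi.single i 1) (n i))
      (m.tmul (Pi.single j 1) (n j)) = if i = j then m.b (n i) (a i • n i) else 0 := by
  refine (m.tensorForm_tmul _ _ _ _ _).trans ?_
  rw [diagForm_single]
  split_ifs with hij
  · rw [hij]
  · rw [zero_smul, HermForm.zero_right]

theorem tensorForm_diagForm {k : ℕ} {a : Fin k → A} (ha : ∀ i, IsSelfAdjoint (a i))
    (n : Fin k → m.N) :
    m.tensorForm (diagForm a ha).form (∑ i, m.tmul (Pi.single i 1) (n i))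
      (∑ i, m.tmul (Pi.single i 1) (n i)) = ∑ i, m.b (n i) (a i • n i) := by
  simp only [HermForm.sum_left, HermForm.sum_right, tensorForm_diagForm_single,
    Finset.sum_ite_eq', Finset.mem_univ, if_true]

theorem mapCone_eq_closure {P : Set A} (hP : ∀ p ∈ P, IsSelfAdjoint p) :
    m.mapCone P = AddSubmonoid.closure {c | ∃ n, ∃ p ∈ P, m.b n (p • n) = c} := by
  ext c
  simp only [mapCone, Set.mem_iUnion, SetLike.mem_coe]
  constructor
  · rintro ⟨_, ⟨k, a, ha, haP, rfl⟩, -, z, rfl⟩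
    obtain ⟨n, rfl⟩ := m.exists_eq_sum_tmul_single z
    exact m.tensorForm_diagForm ha n ▸
      sum_mem fun i _ => AddSubmonoid.subset_closure ⟨n i, a i, haP i, rfl⟩
  · intro hc
    obtain ⟨l, hl, rfl⟩ := AddSubmonoid.exists_list_of_mem_closure hc
    choose n a haP hn using fun i : Fin l.length => hl _ (l.get_mem i)
    have ha i := hP _ (haP i)
    have hsum : m.tensorForm (diagForm a ha).form (∑ i, m.tmul (Pi.single i 1) (n i))
        (∑ i, m.tmul (Pi.single i 1) (n i)) = l.sum := by
      rw [tensorForm_diagForm, Finset.sum_congr rfl fun i _ => hn i]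
      exact Fin.sum_univ_getElem l
    exact ⟨diagForm a ha, ⟨_, a, ha, haP, rfl⟩, hsum ▸ HermForm.star_apply _ _ _, _, hsum⟩

theorem mapCone_mono {P Q : Set A} (h : P ⊆ Q) : m.mapCone P ⊆ m.mapCone Q := by
  refine Set.biUnion_subset_biUnion_left ?_
  rintro _ ⟨k, a, ha, haP, rfl⟩
  exact ⟨k, a, ha, fun i => h (haP i), rfl⟩

variable {m} in
theorem isSelfAdjoint_of_mem_mapCone {P : Set A} {c : B} (hc : c ∈ m.mapCone P) :
    IsSelfAdjoint c := by
  obtain ⟨h, -, hc, -⟩ := Set.mem_iUnion₂.1 hc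
  exact hc

variable {P : Set A} (hP : ∀ p ∈ P, IsSelfAdjoint p)
include hP

theorem b_smul_mem_mapCone (n : m.N) {p : A} (hp : p ∈ P) : m.b n (p • n) ∈ m.mapCone P :=
  m.mapCone_eq_closure hP ▸ AddSubmonoid.subset_closure ⟨n, p, hp, rfl⟩

theorem zero_mem_mapCone : 0 ∈ m.mapCone P :=
  m.mapCone_eq_closure hP ▸ zero_mem (AddSubmonoid.closure _)

variable {m}

theorem add_mem_mapCone {c d : B} (hc : c ∈ m.mapCone P) (hd : d ∈ m.mapCone P) :
    c + d ∈ m.mapCone P := by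
  rw [m.mapCone_eq_closure hP] at *
  exact add_mem hc hd

@[elab_as_elim]
theorem mapCone_induction {motive : ∀ c, c ∈ m.mapCone P → Prop}
    (b_smul : ∀ n p hp, motive (m.b n (p • n)) (m.b_smul_mem_mapCone hP n hp))
    (zero : motive 0 (m.zero_mem_mapCone hP))
    (add : ∀ c hc d hd, motive c hc → motive d hd → motive (c + d) (add_mem_mapCone hP hc hd))
    {c : B} (hc : c ∈ m.mapCone P) : motive c hc := by
  suffices ∃ hc, motive c hc from this.2
  rw [m.mapCone_eq_closure hP] at hc
  induction hc using AddSubmonoid.closure_induction with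
  | mem c hc =>
    obtain ⟨n, p, hp, rfl⟩ := hc
    exact ⟨_, b_smul n p hp⟩
  | zero => exact ⟨_, zero⟩
  | add c d _ _ hc hd => exact ⟨_, add c hc.1 d hd.1 hc.2 hd.2⟩

theorem conj_mem_mapCone {c : B} (hc : c ∈ m.mapCone P) (r : B) :
    star r * c * r ∈ m.mapCone P := by
  induction hc using mapCone_induction hP with
  | b_smul n p hp =>
    rw [← m.b.smul_left, ← m.b.smul_right, ← smul_comm]
    exact m.b_smul_mem_mapCone hP _ hp
  | zero =>
    rw [mul_zero, zero_mul]
    exact m.zero_mem_mapCone hP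
  | add c _ d _ hc hd =>
    rw [mul_add, add_mul]
    exact add_mem_mapCone hP hc hd

theorem coneScalars_subset_coneScalars_mapCone :
    coneScalars F P ⊆ coneScalars F (m.mapCone P) := by
  intro r hr c hc
  induction hc using mapCone_induction hP with
  | b_smul n p hp =>
    have hsmul : r • m.b n (p • n) = m.b n ((r • p) • n) := by
      rw [Algebra.smul_def, Algebra.smul_def, Algebra.commutes, mul_smul, m.algebraMap_smul,
        m.b.smul_right]
    exact hsmul ▸ m.b_smul_mem_mapCone hP n (hr p hp)
  | zero => exact (smul_zero (A := B) r).symm ▸ m.zero_mem_mapCone hP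
  | add c _ d _ hc hd => exact smul_add r c d ▸ add_mem_mapCone hP hc hd

end mapCone

section inverse

/-- For self-adjoint `a`, the image of the one-dimensional form `⟨a⟩` under the Morita equivalence,
carried by `N` itself. -/
def scaledForm {a : A} (ha : IsSelfAdjoint a) : HermForm B m.N where
  toFun x y := m.b x (a • y)
  add_right' x y z := by rw [smul_add, m.b.add_right]
  smul_right' x y c := by rw [smul_comm, m.b.smul_right]
  star_apply' x y := by rw [m.b.star_apply, m.adjoint, ha.star_eq]

theorem exists_b_smul_ne_zero [IsSimpleRing B] (h2 : (2 : B) ≠ 0) {a : A} (ha : IsSelfAdjoint a)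
    (ha0 : a ≠ 0) : ∃ n, m.b n (a • n) ≠ 0 := by
  suffices ∃ x y, m.scaledForm ha x y ≠ 0 from
    have ⟨_, _, hxy⟩ := this
    HermForm.exists_apply_self_ne_zero h2 hxy
  by_contra! hzero
  refine ha0 (m.smul_ext fun y => eq_of_forall_b_right_eq fun x => ?_)
  rw [zero_smul, m.b.zero_right]
  exact hzero x y

variable [Nontrivial A] [IsSimpleRing B]

theorem exists_isIdempotentElem_mul_eq_symm_b_b_smul [IsArtinianRing B] (h2 : (2 : B) ≠ 0) {p : A}
    (hp : IsSelfAdjoint p) (hp0 : p ≠ 0) :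
    ∃ (e : A) (n : m.N) (k : m.symm.N), IsIdempotentElem e ∧ star e * p = p * e ∧ p * e ≠ 0 ∧
      p * e = m.symm.b k (m.b n (p • n) • k) := by
  obtain ⟨n, hn⟩ := m.exists_b_smul_ne_zero h2 hp hp0
  have hc : IsSelfAdjoint (m.b n (p • n)) := (m.scaledForm hp).star_apply n n
  have hc' : m.b (p • n) n = m.b n (p • n) := by rw [← m.b.star_apply, hc.star_eq]
  obtain ⟨d, hd, hdc, hcd⟩ := exists_isSelfAdjoint_generalizedInverse hc
  obtain ⟨k, hk⟩ : ∃ k : m.symm.N, m.ofConj k = op d • p • n := m.ofConj.surjective _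
  refine ⟨m.rankOne (op d • n) (p • n), n, k, ?_, ?_, ?_, ?_⟩
  · rw [IsIdempotentElem, rankOne_mul_rankOne, m.b.smul_right, hc', ← mul_smul, ← op_mul,
      ← mul_assoc, hdc]
  · rw [star_rankOne, rankOne_mul, mul_rankOne, hp.star_eq, smul_comm p, rankOne_op_smul_right,
      hd.star_eq]
  · intro hpe
    apply hn
    calc m.b n (p • n) = m.b n ((p * m.rankOne (op d • n) (p • n)) • n) := by
          rw [mul_smul, rankOne_smul, hc', smul_comm p, smul_comm p, m.b.smul_right,
            m.b.smul_right, hcd]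
      _ = 0 := by rw [hpe, zero_smul, m.b.zero_right]
  · rw [symm_b_smul, hk, hc.star_eq, mul_rankOne, smul_comm p, ← mul_smul, ← op_mul,
      rankOne_op_smul_right, star_mul, hc.star_eq, hd.star_eq, ← mul_smul, ← op_mul, ← mul_assoc,
      hdc]

theorem symm_mapCone_mapCone_subset {P : Set A} (hP : IsPrepositiveCone F P) :
    m.symm.mapCone (m.mapCone P) ⊆ P := by
  have hgen (k : m.symm.N) {c : B} (hc : c ∈ m.mapCone P) : m.symm.b k (c • k) ∈ P := by
    induction hc using mapCone_induction hP.isSelfAdjoint with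
    | b_smul n p hp => exact m.symm_b_b_smul p n k ▸ hP.conj_mem _ p hp
    | zero => exact (zero_smul B k).symm ▸ (m.symm.b.zero_right k).symm ▸ hP.zero_mem
    | add c _ d _ hc hd =>
      rw [add_smul, m.symm.b.add_right]
      exact hP.add_mem _ hc _ hd
  intro a ha
  induction ha using mapCone_induction fun _ => isSelfAdjoint_of_mem_mapCone with
  | b_smul k c hc => exact hgen k hc
  | zero => exact hP.zero_mem
  | add a _ a' _ ha ha' => exact hP.add_mem a ha a' ha'

theorem subset_symm_mapCone_mapCone [IsArtinianRing A] [IsArtinianRing B] {P : Set A}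
    (hP : IsPrepositiveCone F P) : P ⊆ m.symm.mapCone (m.mapCone P) := by
  have hself : ∀ c ∈ m.mapCone P, IsSelfAdjoint c := fun _ => isSelfAdjoint_of_mem_mapCone
  intro p
  induction p using
    (InvImage.wf (fun p : A => Ideal.span {p}) (wellFounded_lt (α := Ideal A))).induction with
  | h p ih =>
    intro hp
    rcases eq_or_ne p 0 with rfl | hp0
    · exact m.symm.zero_mem_mapCone hself
    have hpadj := hP.isSelfAdjoint p hp
    obtain ⟨e, n, k, he, hep, hpe0, hpe⟩ :=
      m.exists_isIdempotentElem_mul_eq_symm_b_b_smul (hP.two_ne_zero B) hpadj hp0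
    have hpe_mem : p * e ∈ m.symm.mapCone (m.mapCone P) :=
      hpe ▸ m.symm.b_smul_mem_mapCone hself k (m.b_smul_mem_mapCone hP.isSelfAdjoint n hp)
    have hconj : star (1 - e) * p * (1 - e) = p - p * e := by
      rw [star_sub, star_one, sub_mul, one_mul, hep, ← mul_one_sub, mul_assoc,
        he.one_sub.eq]
    have hlt : Ideal.span {p - p * e} < Ideal.span {p} := by
      refine lt_of_le_not_ge ?_ fun hle => hpe0 ?_
      · rw [Ideal.span_singleton_le_iff_mem, ← hep]
        exact Ideal.mem_span_singleton'.2 ⟨1 - star e, one_sub_mul _ _⟩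
      · obtain ⟨z, hz⟩ := Ideal.mem_span_singleton'.1 (hle (Ideal.mem_span_singleton_self p))
        rw [← hz, mul_assoc, ← mul_one_sub, mul_assoc, he.one_sub_mul_self, mul_zero, mul_zero]
    rw [← sub_add_cancel p (p * e)]
    exact add_mem_mapCone hself (ih _ hlt (hconj ▸ hP.conj_mem _ p hp)) hpe_mem

variable [IsArtinianRing A] [IsArtinianRing B]

theorem symm_mapCone_mapCone {P : Set A} (hP : IsPrepositiveCone F P) :
    m.symm.mapCone (m.mapCone P) = P :=
  (m.symm_mapCone_mapCone_subset hP).antisymm (m.subset_symm_mapCone_mapCone hP)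

theorem mapCone_subset_mapCone_iff {P Q : Set A} (hP : IsPrepositiveCone F P)
    (hQ : IsPrepositiveCone F Q) : m.mapCone P ⊆ m.mapCone Q ↔ P ⊆ Q := by
  refine ⟨fun h => ?_, m.mapCone_mono⟩
  rw [← m.symm_mapCone_mapCone hP, ← m.symm_mapCone_mapCone hQ]
  exact m.symm.mapCone_mono h

theorem coneScalars_mapCone {P : Set A} (hP : IsPrepositiveCone F P) :
    coneScalars F (m.mapCone P) = coneScalars F P := by
  refine Set.Subset.antisymm ?_ (coneScalars_subset_coneScalars_mapCone hP.isSelfAdjoint)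
  conv_rhs => rw [← m.symm_mapCone_mapCone hP]
  exact coneScalars_subset_coneScalars_mapCone fun _ => isSelfAdjoint_of_mem_mapCone

end inverse

section bijOn

variable [IsSimpleRing A] [IsSimpleRing B]

theorem symm_symm_b_smul (a : A) (n : m.symm.symm.N) :
    m.symm.symm.b n (a • n) =
      m.b (m.ofConj (m.symm.ofConj n)) (a • m.ofConj (m.symm.ofConj n)) := by
  rw [symm_b_smul, symm_rankOne]
  exact congrArg (fun a => m.b _ (a • _)) (star_star a)

theorem symm_symm_mapCone {P : Set A} (hP : ∀ p ∈ P, IsSelfAdjoint p) :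
    m.symm.symm.mapCone P = m.mapCone P := by
  rw [mapCone_eq_closure _ hP, mapCone_eq_closure _ hP]
  simp only [symm_symm_b_smul]
  rfl

variable [IsArtinianRing A] [IsArtinianRing B]

theorem isPrepositiveCone_mapCone {P : Set A} (hP : IsPrepositiveCone F P) :
    IsPrepositiveCone F (m.mapCone P) where
  isSelfAdjoint _ := isSelfAdjoint_of_mem_mapCone
  nonempty := ⟨0, m.zero_mem_mapCone hP.isSelfAdjoint⟩
  add_mem _ hc _ hd := add_mem_mapCone hP.isSelfAdjoint hc hd
  conj_mem r _ hc := conj_mem_mapCone hP.isSelfAdjoint hc r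
  isFieldOrdering := m.coneScalars_mapCone hP ▸ hP.isFieldOrdering
  proper := by
    have hself : ∀ c ∈ m.mapCone P, IsSelfAdjoint c := fun _ => isSelfAdjoint_of_mem_mapCone
    have hmem (k : m.symm.N) {c : B} (hc : c ∈ m.mapCone P) : m.symm.b k (c • k) ∈ P :=
      m.symm_mapCone_mapCone_subset hP (m.symm.b_smul_mem_mapCone hself k hc)
    refine Set.eq_singleton_iff_unique_mem.2 ⟨?_, fun c hc => ?_⟩
    · have h0 := m.zero_mem_mapCone hP.isSelfAdjoint
      exact ⟨h0, by rwa [Set.mem_ofPred_eq, neg_zero]⟩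
    · by_contra hc0
      obtain ⟨k, hk⟩ := m.symm.exists_b_smul_ne_zero (hP.two_ne_zero A) (hself c hc.1) hc0
      refine hk (hP.eq_zero_of_neg_mem (hmem k hc.1) ?_)
      simpa only [neg_smul, HermForm.neg_right] using hmem k hc.2

theorem bijOn_mapCone_prepositiveCones :
    Set.BijOn m.mapCone (prepositiveCones F A) (prepositiveCones F B) := by
  refine Set.InvOn.bijOn (f' := m.symm.mapCone) ⟨fun P => m.symm_mapCone_mapCone, fun Q hQ => ?_⟩
    (fun P => m.isPrepositiveCone_mapCone) fun Q => m.symm.isPrepositiveCone_mapCone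
  rw [← m.symm_symm_mapCone fun _ => isSelfAdjoint_of_mem_mapCone]
  exact m.symm.symm_mapCone_mapCone hQ

end bijOn

end MoritaEquiv

theorem IsAlgebraWithInvolution.isArtinianRing (F : Type*) {A : Type*} [Field F] [Ring A]
    [Algebra F A] [StarRing A] [IsAlgebraWithInvolution F A] : IsArtinianRing A :=
  have : FiniteDimensional F A := finiteDimensional
  .of_finite F A

end PosCone

theorem theorem4p1_general {F A B : Type*} [Field F]
    [Ring A] [Algebra F A] [StarRing A] [IsSimpleRing A] [IsArtinianRing A]
    [Ring B] [Algebra F B] [StarRing B] [IsSimpleRing B] [IsArtinianRing B]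
    (m : MoritaEquiv F A B) :
    Set.BijOn m.mapCone (prepositiveCones F A) (prepositiveCones F B) ∧
    (∀ P ∈ prepositiveCones F A, ∀ Q ∈ prepositiveCones F A,
      P ⊆ Q ↔ m.mapCone P ⊆ m.mapCone Q) ∧
    Set.BijOn m.mapCone (positiveCones F A) (positiveCones F B) ∧
    (∀ P ∈ prepositiveCones F A, coneScalars F (m.mapCone P) = coneScalars F P) :=
  have hbij := m.bijOn_mapCone_prepositiveCones
  ⟨hbij, fun _ hP _ hQ => (m.mapCone_subset_mapCone_iff hP hQ).symm,
    bijOn_setOf_maximal hbij fun _ hP _ hQ => m.mapCone_subset_mapCone_iff hP hQ,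
    fun _ => m.coneScalars_mapCone⟩

theorem theorem4p1 {F : Type*} {A : Type*} {B : Type*} [Field F] (hF : (2 : F) ≠ 0)
    [Ring A] [Algebra F A] [StarRing A] [IsAlgebraWithInvolution F A]
    [Ring B] [Algebra F B] [StarRing B] [IsAlgebraWithInvolution F B]
    (htype : SameType F A B) (𝔪 : MoritaEquiv F A B) :
    Set.BijOn 𝔪.mapCone (prepositiveCones F A) (prepositiveCones F B) ∧
    (∀ P ∈ prepositiveCones F A, ∀ Q ∈ prepositiveCones F A,
      P ⊆ Q ↔ 𝔪.mapCone P ⊆ 𝔪.mapCone Q) ∧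
    Set.BijOn 𝔪.mapCone (positiveCones F A) (positiveCones F B) ∧
    (∀ P ∈ prepositiveCones F A, ∀ O : Set F, IsFieldOrdering O →
      coneScalars F P = O → coneScalars F (𝔪.mapCone P) = O) := by
  have := IsAlgebraWithInvolution.isSimpleRing F (A := A)
  have := IsAlgebraWithInvolution.isSimpleRing F (A := B)
  have := IsAlgebraWithInvolution.isArtinianRing F (A := A)
  have := IsAlgebraWithInvolution.isArtinianRing F (A := B)
  obtain ⟨hprepositive, hsubset, hpositive, hscalars⟩ := theorem4p1_general 𝔪
  exact ⟨hprepositive, hsubset, hpositive, fun P hP _ _ hO => (hscalars P hP).trans hO⟩
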